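/- Let $r\ge 1$, let $\mathcal A=\{1,\dots,r\}$ and let $\Omega=\mathcal A^{\mathbb N}$ carry the metric $d(x,y)=2^{-\min\{n\ge 1:\,x_n\ne y_n\}}$ for $x\neq y$, $d(x,x)=0$. For $j\in\mathcal A$ and $x=(x_1,x_2,\dots)\in\Omega$ write $jx=(j,x_1,x_2,\dots)$. Let $\beta>0$, $\mu<0$, and let $(A_N)_{N\ge 0}$ be a family of functions $A_N:\Omega\to\mathbb R$ such that * (H1) there is $M>0$ with $|A_N(x)-A_N(y)|\le M\,d(x,y)$ for all $N\ge 0$ and all $x,y\in\Omega$; * (H2) $\limsup_{N\to\infty}\frac{A_N(x)}{N}>\mu$ for all $x\in\Omega$. Consider the admissibility condition $$\sum_{N\ge 0}e^{\beta\mu N}\sum_{j\in\mathcal A}e^{-\beta A_N(jx)}<\infty\qquad\text{for all }x\in\Omega .$$ (i) If $\liminf_{N\to\infty}\frac{A_N(x)}{N}>\mu$ for all $x\in\Omega$, then the family is admissible. (ii) If the family is admissible, then the grand-canonical-Ruelle operator $$(\mathcal L_{\beta,\mu}f)(x)=\sum_{N\ge 0}e^{\beta\mu N}\sum_{j\in\mathcal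 A}e^{-\beta A_N(jx)}f(jx)$$ is given by a convergent series and is a bounded linear operator on the space $C(\Omega)$ of continuous functions with the supremum norm, its spectral radius $\lambda$ on $C(\Omega)$ is positive and finite (and is the same for real- and for complex-valued functions), $\mathcal L_{\beta,\mu}^n1>0$ for all $n\ge 0$, and $$\lim_{n\to\infty}\frac1n\log\bigl((\mathcal L_{\beta,\mu}^n 1)(x)\bigr)=\log\lambda\qquad\text{uniformly in }x\in\Omega .$$ -/

import Mathlib

open Filter Topology

namespace GrandCanonical

/-- The symbolic space `Ω = 𝒜^ℕ` over an alphabet `𝒜` with `r` letters, with its product topology.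
The coordinate `x 0` is the first letter of the sequence. -/
abbrev Seq (r : ℕ) : Type := ℕ → Fin r

/-- The metric `d(x, y) = 2 ^ (-min {n : x_n ≠ y_n})` for `x ≠ y`, and `d(x, x) = 0`. Sequences are
enumerated from `1` in this formula, whence the shift of the exponent. -/
noncomputable def symDist {r : ℕ} (x y : Seq r) : ℝ :=
  open Classical in
  if x = y then 0 else (1 / 2 : ℝ) ^ (PiNat.firstDiff x y + 1)

/-- The metric `symDist` induces the product topology. -/
theorem isOpen_iff_symDist {r : ℕ} (s : Set (Seq r)) :
    IsOpen s ↔ ∀ x ∈ s, ∃ ε > 0, ∀ y, symDist x y < ε → y ∈ s := by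
  have key : ∀ x y : Seq r, (PiNat.dist.dist x y : ℝ) = 2 * symDist x y := by
    intro x y
    by_cases h : x = y
    · subst h
      simp [symDist, PiNat.dist_self]
    · rw [PiNat.dist_eq_of_ne h, symDist, if_neg h, pow_succ]
      ring
  rw [PiNat.isOpen_iff_dist]
  refine forall₂_congr fun x _ => ⟨?_, ?_⟩
  · rintro ⟨ε, hε, h⟩
    refine ⟨ε / 2, by positivity, fun y hy => h y ?_⟩
    rw [key]
    linarith
  · rintro ⟨ε, hε, h⟩
    refine ⟨2 * ε, by positivity, fun y hy => h y ?_⟩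
    rw [key] at hy
    linarith

/-- The sequence `a x = (a, x₁, x₂, …)`. -/
def prepend {r : ℕ} (a : Fin r) (x : Seq r) : Seq r
  | 0 => a
  | n + 1 => x n

/-- The potentials `A_N` are Lipschitz with a constant `M > 0` that does not depend on `N`. -/
def UniformlyLipschitz {r : ℕ} (A : ℕ → Seq r → ℝ) : Prop :=
  ∃ M > 0, ∀ N x y, |A N x - A N y| ≤ M * symDist x y

/-- Superlinearity with constant `K`: `limsup A_N(x) / N > K` for every `x`, the limsup being taken
in the extended reals. -/
def Superlinear {r : ℕ} (A : ℕ → Seq r → ℝ) (K : ℝ) : Prop :=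
  ∀ x, (K : EReal) < limsup (fun N : ℕ => ((A N x / N : ℝ) : EReal)) atTop

/-- The lower version of superlinearity: `liminf A_N(x) / N > K` for every `x`. -/
def LowerSuperlinear {r : ℕ} (A : ℕ → Seq r → ℝ) (K : ℝ) : Prop :=
  ∀ x, (K : EReal) < liminf (fun N : ℕ => ((A N x / N : ℝ) : EReal)) atTop

/-- Admissibility: `∑_N e^{βμN} ∑_a e^{-β A_N(ax)} < ∞` for every `x`. -/
def Admissible {r : ℕ} (A : ℕ → Seq r → ℝ) (β μ : ℝ) : Prop :=
  ∀ x, Summable fun N : ℕ =>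
    Real.exp (β * μ * N) * ∑ a : Fin r, Real.exp (-β * A N (prepend a x))

/-- `L` is the grand-canonical-Ruelle operator on the continuous `𝕜`-valued functions
(`𝕜 = ℝ` or `ℂ`): for every `f` and `x`, the series
`∑_N e^{βμN} ∑_a e^{-β A_N(ax)} f(ax)` converges, and its sum is `(L f)(x)`. These equations
determine `L`. -/
def IsRuelleOperator (𝕜 : Type) [RCLike 𝕜] {r : ℕ} (A : ℕ → Seq r → ℝ) (β μ : ℝ)
    (L : C(Seq r, 𝕜) →L[𝕜] C(Seq r, 𝕜)) : Prop :=
  ∀ (f : C(Seq r, 𝕜)) (x : Seq r),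
    HasSum (fun N : ℕ => (Real.exp (β * μ * N) : 𝕜) *
      ∑ a : Fin r, (Real.exp (-β * A N (prepend a x)) : 𝕜) * f (prepend a x)) (L f x)

end GrandCanonical

namespace GrandCanonical

/-! ### The symbolic metric, prepending and bounded distortion. -/

variable {r : ℕ}

/-! Summing over `N` first turns the operator into an ordinary transfer operator with weight `G y =
∑ N, exp (βμN - β A_N y)`. By the uniform Lipschitz bound, `log G` is Lipschitz with constant `K =
βM`. Prepending a letter halves distances, so every `L^n 1` has this same constant `K`; since the
diameter is at most `1/2`, its values agree up to a factor `exp (K/2)`. Positivity gives `‖L^n‖ =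
‖L^n 1‖` over `ℝ` and `ℂ` alike. Gelfand's formula over `ℂ` gives `(1/n) log ‖L^n‖ → log λ`, and
bounded distortion replaces the norm by the value at any `x` with error at most `K/(2n)`. Over `ℝ`,
where `spectralRadius` sees only real spectrum, `λ` must be shown to be a spectral value: the
Neumann series applied to `1` makes the resolvent blow up as `t ↓ λ`. Part (i) is a comparison with
a geometric series. -/

theorem symDist_nonneg (x y : Seq r) : 0 ≤ symDist x y := by
  unfold symDist
  split_ifs <;> positivity

theorem symDist_le_of_mem_cylinder {x y : Seq r} {n : ℕ}
    (h : y ∈ PiNat.cylinder (E := fun _ => Fin r) x n) : symDist x y ≤ (1 / 2 : ℝ) ^ (n + 1) := by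
  unfold symDist
  split_ifs with hxy
  · positivity
  · have hn := (PiNat.mem_cylinder_iff_le_firstDiff (Ne.symm hxy) n).1 h
    rw [PiNat.firstDiff_comm] at hn
    exact pow_le_pow_of_le_one (by norm_num) (by norm_num) (by omega)

theorem symDist_le_half (x y : Seq r) : symDist x y ≤ 1 / 2 := by
  simpa using symDist_le_of_mem_cylinder (x := x) (y := y) (n := 0) (by simp)

theorem symDist_prepend_le (a : Fin r) (x y : Seq r) :
    symDist (prepend a x) (prepend a y) ≤ symDist x y / 2 := by
  by_cases hxy : x = y
  · simp [hxy, symDist]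
  · have hmem : prepend a y ∈
        PiNat.cylinder (E := fun _ => Fin r) (prepend a x) (PiNat.firstDiff x y + 1) := by
      rw [PiNat.mem_cylinder_iff]
      rintro (_ | i) hi
      · rfl
      · exact (PiNat.apply_eq_of_lt_firstDiff (Nat.lt_of_succ_lt_succ hi)).symm
    refine (symDist_le_of_mem_cylinder hmem).trans_eq ?_
    rw [symDist, if_neg hxy, pow_succ _ (_ + 1)]
    ring

theorem continuous_of_symDist_bound {F : Seq r → ℝ} {M : ℝ} (hM : 0 ≤ M)
    (hF : ∀ x y, |F x - F y| ≤ M * symDist x y) : Continuous F := by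
  refine continuous_iff_continuousAt.2 fun x => Metric.tendsto_nhds.2 fun ε hε => ?_
  obtain ⟨n, hn⟩ := exists_pow_lt_of_lt_one (show 0 < ε / (M + 1) by positivity)
    (show (1 / 2 : ℝ) < 1 by norm_num)
  filter_upwards [(PiNat.isOpen_cylinder (fun _ => Fin r) x n).mem_nhds
    (PiNat.self_mem_cylinder x n)] with y hy
  rw [lt_div_iff₀ (by positivity)] at hn
  rw [dist_comm, Real.dist_eq]
  have h1 : symDist x y ≤ (1 / 2) ^ n := (symDist_le_of_mem_cylinder hy).trans
    (pow_le_pow_of_le_one (by norm_num) (by norm_num) (by omega))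
  have h2 : (0 : ℝ) < (1 / 2) ^ n := by positivity
  nlinarith [hF x y, mul_le_mul_of_nonneg_left h1 hM]

theorem continuous_prepend (a : Fin r) : Continuous (prepend a) :=
  continuous_pi fun
    | 0 => continuous_const
    | n + 1 => continuous_apply n

theorem prepend_tail (y : Seq r) : prepend (y 0) (fun n => y (n + 1)) = y := by
  funext n
  cases n <;> rfl

/-- The variation of `log f` is at most `K * symDist`, stated without logarithms. -/
def LogLipschitz (K : ℝ) (f : Seq r → ℝ) : Prop :=
  ∀ x y, f x ≤ Real.exp (K * symDist x y) * f y

theorem LogLipschitz.le_exp_half {K : ℝ} {f : Seq r → ℝ} (hf : LogLipschitz K f) (hK : 0 ≤ K)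
    (h0 : ∀ x, 0 ≤ f x) (x y : Seq r) : f x ≤ Real.exp (K / 2) * f y := by
  refine (hf x y).trans (mul_le_mul_of_nonneg_right (Real.exp_le_exp.2 ?_) (h0 y))
  nlinarith [symDist_le_half x y]

/-! ### Positive transfer operators and their iterates on the constant `1`. -/

section Transfer

variable (𝕜 : Type) [RCLike 𝕜]

/-- The transfer operator `(L f)(x) = ∑ a, G(a x) f(a x)` with weight `G`. -/
noncomputable def transfer (G : C(Seq r, ℝ)) : C(Seq r, 𝕜) →L[𝕜] C(Seq r, 𝕜) :=
  let g : C(Seq r, 𝕜) := ⟨fun x => (G x : 𝕜), by fun_prop⟩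
  ∑ a : Fin r,
    { toFun := fun f => (g * f).comp ⟨_, continuous_prepend a⟩
      map_add' := fun f₁ f₂ => by ext x; simp [mul_add]
      map_smul' := fun c f => by ext x; simp
      cont := (ContinuousMap.continuous_precomp _).comp (continuous_const_mul g) }

@[simp]
theorem transfer_apply (G : C(Seq r, ℝ)) (f : C(Seq r, 𝕜)) (x : Seq r) :
    transfer 𝕜 G f x = ∑ a : Fin r, (G (prepend a x) : 𝕜) * f (prepend a x) := by
  simp [transfer]

theorem transfer_pow_succ_apply (G : C(Seq r, ℝ)) (n : ℕ) (f : C(Seq r, 𝕜)) (x : Seq r) :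
    (transfer 𝕜 G ^ (n + 1)) f x =
      ∑ a : Fin r, (G (prepend a x) : 𝕜) * (transfer 𝕜 G ^ n) f (prepend a x) := by
  rw [pow_succ', mul_apply_eq_comp, transfer_apply]

variable {G : C(Seq r, ℝ)}

theorem norm_transfer_pow_apply_le (hG : ∀ x, 0 < G x) {f : C(Seq r, 𝕜)} {h : C(Seq r, ℝ)}
    (hfh : ∀ x, ‖f x‖ ≤ h x) (n : ℕ) (x : Seq r) :
    ‖(transfer 𝕜 G ^ n) f x‖ ≤ (transfer ℝ G ^ n) h x := by
  induction n generalizing x with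
  | zero => exact hfh x
  | succ n ih =>
    rw [transfer_pow_succ_apply, transfer_pow_succ_apply]
    refine (norm_sum_le _ _).trans (Finset.sum_le_sum fun a _ => ?_)
    rw [norm_mul, RCLike.norm_ofReal, abs_of_pos (hG _)]
    exact mul_le_mul_of_nonneg_left (ih _) (hG _).le

theorem transfer_pow_one_eq_ofReal (G : C(Seq r, ℝ)) (n : ℕ) (x : Seq r) :
    (transfer 𝕜 G ^ n) 1 x = (((transfer ℝ G ^ n) 1 x : ℝ) : 𝕜) := by
  induction n generalizing x with
  | zero => simp
  | succ n ih =>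
    rw [transfer_pow_succ_apply, transfer_pow_succ_apply]
    simp_rw [ih, RCLike.ofReal_sum, RCLike.ofReal_mul, RCLike.ofReal_real_eq_id, id]

/-- A positive operator attains its norm at `1`, because `|f| ≤ ‖f‖ • 1` is preserved by the
iterates. The right side does not involve `𝕜`. -/
theorem norm_transfer_pow (hG : ∀ x, 0 < G x) (n : ℕ) :
    ‖transfer 𝕜 G ^ n‖ = ‖(transfer ℝ G ^ n) 1‖ := by
  apply le_antisymm
  · refine ContinuousLinearMap.opNorm_le_bound _ (norm_nonneg _) fun f => ?_
    refine (ContinuousMap.norm_le _ (by positivity)).2 fun x => ?_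
    have h := norm_transfer_pow_apply_le 𝕜 hG (f := f) (h := ‖f‖ • 1)
      (fun y => by simpa using f.norm_coe_le_norm y) n x
    rw [map_smul, ContinuousMap.smul_apply, smul_eq_mul] at h
    refine h.trans ?_
    rw [mul_comm]
    gcongr
    exact (le_abs_self _).trans (((transfer ℝ G ^ n) 1).norm_coe_le_norm x)
  · refine (ContinuousMap.norm_le _ (norm_nonneg _)).2 fun x => ?_
    have h1 : ‖(1 : C(Seq r, 𝕜))‖ ≤ 1 :=
      (ContinuousMap.norm_le _ zero_le_one).2 fun y => by simp
    calc ‖(transfer ℝ G ^ n) 1 x‖ = ‖(transfer 𝕜 G ^ n) 1 x‖ := by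
          rw [transfer_pow_one_eq_ofReal 𝕜, RCLike.norm_ofReal, Real.norm_eq_abs]
      _ ≤ ‖(transfer 𝕜 G ^ n) 1‖ := ContinuousMap.norm_coe_le_norm _ x
      _ ≤ ‖transfer 𝕜 G ^ n‖ * ‖(1 : C(Seq r, 𝕜))‖ := ContinuousLinearMap.le_opNorm _ _
      _ ≤ ‖transfer 𝕜 G ^ n‖ := mul_le_of_le_one_right (norm_nonneg _) h1

theorem pow_le_transfer_pow_one [Nonempty (Fin r)] {c : ℝ} (hc : 0 ≤ c) (hG : ∀ x, c ≤ G x)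
    (n : ℕ) (x : Seq r) : c ^ n ≤ (transfer ℝ G ^ n) 1 x := by
  induction n generalizing x with
  | zero => simp
  | succ n ih =>
    rw [transfer_pow_succ_apply, pow_succ']
    have hterm : ∀ a : Fin r, c * c ^ n ≤ G (prepend a x) * (transfer ℝ G ^ n) 1 (prepend a x) :=
      fun a => mul_le_mul (hG _) (ih _) (by positivity) (hc.trans (hG _))
    exact (hterm (Classical.arbitrary _)).trans (Finset.single_le_sum
      (f := fun a => G (prepend a x) * (transfer ℝ G ^ n) 1 (prepend a x))
      (fun a _ => (by positivity : 0 ≤ c * c ^ n).trans (hterm a)) (Finset.mem_univ _))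

/-- The constant does not grow with `n`: the weight and the previous iterate each contribute `K *
symDist x y / 2`. -/
theorem logLipschitz_transfer_pow_one {K : ℝ} (hK : 0 ≤ K) (hG : ∀ x, 0 < G x)
    (hGK : LogLipschitz K G) (n : ℕ) : LogLipschitz K ((transfer ℝ G ^ n) 1) := by
  induction n with
  | zero =>
    intro x y
    simpa using mul_nonneg hK (symDist_nonneg x y)
  | succ n ih =>
    intro x y
    rw [transfer_pow_succ_apply, transfer_pow_succ_apply, Finset.mul_sum]
    refine Finset.sum_le_sum fun a _ => ?_
    have h0 : ∀ z, 0 ≤ (transfer ℝ G ^ n) 1 z := fun z => by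
      have := norm_transfer_pow_apply_le ℝ hG (f := 0) (h := 1) (fun _ => by simp) n z
      exact (norm_nonneg _).trans this
    refine (mul_le_mul (hGK _ (prepend a y)) (ih _ (prepend a y)) (h0 _)
      (mul_nonneg (Real.exp_pos _).le (hG _).le)).trans ?_
    simp only [RCLike.ofReal_real_eq_id, id]
    rw [mul_mul_mul_comm, ← Real.exp_add]
    refine mul_le_mul_of_nonneg_right (Real.exp_le_exp.2 ?_) (mul_nonneg (hG _).le (h0 _))
    nlinarith [symDist_prepend_le a x y]

end Transfer

/-- At a point of the resolvent set the resolvent is continuous, which would force the product to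
tend to `0`. -/
theorem mem_spectrum_of_le_mul_norm_resolvent {E : Type*} [NormedAddCommGroup E] [NormedSpace ℝ E]
    [CompleteSpace E] (T : E →L[ℝ] E) {s c : ℝ} (hc : 0 < c)
    (h : ∀ t, s < t → c ≤ (t - s) * ‖resolvent T t‖) : s ∈ spectrum ℝ T := by
  by_contra hs
  have hcont : ContinuousAt (resolvent T) s :=
    (spectrum.hasDerivAt_resolvent_const_left (Set.notMem_compl_iff.1 hs)).continuousAt
  have hlim : Tendsto (fun t => (t - s) * ‖resolvent T t‖) (𝓝[>] s)
      (𝓝 ((s - s) * ‖resolvent T s‖)) :=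
    ((tendsto_id.sub_const s).mul hcont.norm).mono_left nhdsWithin_le_nhds
  have := ge_of_tendsto hlim (eventually_mem_nhdsWithin.mono h)
  rw [sub_self, zero_mul] at this
  exact hc.not_ge this

/-! ### Real and complex spectral radius, and the growth rate of the iterates. -/

section SpectralRadius

variable {G : C(Seq r, ℝ)}

theorem norm_transfer_pow_real_eq_complex (hG : ∀ x, 0 < G x) (n : ℕ) :
    ‖transfer ℝ G ^ n‖ = ‖transfer ℂ G ^ n‖ := by
  rw [norm_transfer_pow ℝ hG, norm_transfer_pow ℂ hG]

theorem spectralRadius_real_transfer_le (hG : ∀ x, 0 < G x) :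
    spectralRadius ℝ (transfer ℝ G) ≤ spectralRadius ℂ (transfer ℂ G) := by
  refine (spectrum.spectralRadius_le_liminf_pow_nnnorm_pow_one_div ℝ (transfer ℝ G)).trans_eq ?_
  rw [← (spectrum.pow_nnnorm_pow_one_div_tendsto_nhds_spectralRadius (transfer ℂ G)).liminf_eq]
  refine congrArg (fun u => liminf u atTop) (funext fun n => ?_)
  rw [show ‖transfer ℝ G ^ n‖₊ = ‖transfer ℂ G ^ n‖₊ from
    NNReal.eq (norm_transfer_pow_real_eq_complex hG n)]

variable [Nonempty (Fin r)]

theorem spectralRadius_transfer_ne_top :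
    spectralRadius ℂ (transfer ℂ G) ≠ ⊤ :=
  ((spectrum.spectralRadius_le_nnnorm (𝕜 := ℂ) (transfer ℂ G)).trans_lt ENNReal.coe_lt_top).ne

theorem tendsto_norm_transfer_pow (hG : ∀ x, 0 < G x) :
    Tendsto (fun n : ℕ => ‖transfer ℝ G ^ n‖ ^ (1 / n : ℝ)) atTop
      (𝓝 (spectralRadius ℂ (transfer ℂ G)).toReal) := by
  have h := (ENNReal.tendsto_toReal spectralRadius_transfer_ne_top).comp
    (spectrum.pow_norm_pow_one_div_tendsto_nhds_spectralRadius (transfer ℂ G))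
  refine h.congr fun n => ?_
  rw [Function.comp_apply, ENNReal.toReal_ofReal (by positivity),
    norm_transfer_pow_real_eq_complex hG]

theorem spectralRadius_transfer_pow_le (hG : ∀ x, 0 < G x) (n : ℕ) :
    (spectralRadius ℂ (transfer ℂ G)).toReal ^ n ≤ ‖transfer ℝ G ^ n‖ := by
  have h := (spectrum.spectralRadius_pow_le' (𝕜 := ℂ) (transfer ℂ G) n).trans
    (spectrum.spectralRadius_le_nnnorm (𝕜 := ℂ) (transfer ℂ G ^ n))
  have h2 := ENNReal.toReal_mono ENNReal.coe_ne_top h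
  rwa [ENNReal.toReal_pow, ENNReal.coe_toReal, coe_nnnorm,
    ← norm_transfer_pow_real_eq_complex hG] at h2

theorem exists_pos_le_weight (hG : ∀ x, 0 < G x) : ∃ c > 0, ∀ x, c ≤ G x := by
  obtain ⟨x₀, -, hx₀⟩ := isCompact_univ.exists_isMinOn Set.univ_nonempty G.continuous.continuousOn
  exact ⟨G x₀, hG x₀, fun x => hx₀ (Set.mem_univ x)⟩

theorem transfer_pow_one_pos (hG : ∀ x, 0 < G x) (n : ℕ) (x : Seq r) :
    0 < (transfer ℝ G ^ n) 1 x := by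
  obtain ⟨c, hc, hcG⟩ := exists_pos_le_weight hG
  exact (pow_pos hc n).trans_le (pow_le_transfer_pow_one hc.le hcG n x)

theorem spectralRadius_transfer_pos (hG : ∀ x, 0 < G x) :
    0 < (spectralRadius ℂ (transfer ℂ G)).toReal := by
  obtain ⟨c, hc, hcG⟩ := exists_pos_le_weight hG
  refine hc.trans_le (ge_of_tendsto (tendsto_norm_transfer_pow hG) ?_)
  filter_upwards [eventually_ge_atTop 1] with n hn
  have h : c ^ n ≤ ‖transfer ℝ G ^ n‖ := by
    rw [norm_transfer_pow ℝ hG]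
    exact (pow_le_transfer_pow_one hc.le hcG n (Classical.arbitrary _)).trans
      (ContinuousMap.apply_le_norm _ _)
  calc c = (c ^ n) ^ (1 / n : ℝ) := by
        rw [one_div, Real.pow_rpow_inv_natCast hc.le (by omega)]
    _ ≤ _ := Real.rpow_le_rpow (by positivity) h (by positivity)

theorem norm_transfer_pow_le_transfer_pow_one {K : ℝ} (hK : 0 ≤ K) (hG : ∀ x, 0 < G x)
    (hGK : LogLipschitz K G) (n : ℕ) (x : Seq r) :
    ‖transfer ℝ G ^ n‖ ≤ Real.exp (K / 2) * (transfer ℝ G ^ n) 1 x := by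
  have hpos := transfer_pow_one_pos hG n
  rw [norm_transfer_pow ℝ hG]
  refine (ContinuousMap.norm_le _ (mul_nonneg (Real.exp_pos _).le (hpos x).le)).2 fun y => ?_
  rw [Real.norm_eq_abs, abs_of_pos (hpos y)]
  exact (logLipschitz_transfer_pow_one hK hG hGK n).le_exp_half hK (fun z => (hpos z).le) y x

/-- Bounded distortion makes the resolvent blow up at the spectral radius at least like
`1 / (t - λ)`. -/
theorem exp_neg_le_mul_norm_resolvent {K : ℝ} (hK : 0 ≤ K) (hG : ∀ x, 0 < G x)
    (hGK : LogLipschitz K G) {t : ℝ} (ht : (spectralRadius ℂ (transfer ℂ G)).toReal < t) :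
    Real.exp (-(K / 2)) ≤ (t - (spectralRadius ℂ (transfer ℂ G)).toReal) *
      ‖resolvent (transfer ℝ G) t‖ := by
  set lam := (spectralRadius ℂ (transfer ℂ G)).toReal with hlam
  set T := transfer ℝ G with hT
  have hlam0 : 0 < lam := spectralRadius_transfer_pos hG
  have ht0 : 0 < t := hlam0.trans ht
  have hres : t ∈ resolventSet ℝ T := by
    refine spectrum.mem_resolventSet_of_spectralRadius_lt
      ((spectralRadius_real_transfer_le hG).trans_lt ?_)
    rw [← ENNReal.ofReal_toReal (spectralRadius_transfer_ne_top (G := G)), ← hlam]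
    rw [← enorm_eq_nnnorm, Real.enorm_eq_ofReal ht0.le]
    exact (ENNReal.ofReal_lt_ofReal_iff ht0).2 ht
  set R := resolvent T t
  have hinv : (algebraMap ℝ _ t - T) * R = 1 := Ring.mul_inverse_cancel _ hres
  set S := t⁻¹ • T with hS
  have hinv' : (1 - S) * (t • R) = 1 := by
    refine Eq.trans ?_ hinv
    rw [hS, Algebra.algebraMap_eq_smul_one, mul_smul_comm, ← smul_mul_assoc, smul_sub,
      smul_smul, mul_inv_cancel₀ ht0.ne', one_smul]
  -- Since `t • R` inverts `1 - S`, partial Neumann sums are expressed through the resolvent.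
  have hsum : ∀ n : ℕ, ∑ k ∈ Finset.range n, S ^ k = (1 - S ^ n) * (t • R) := fun n => by
    rw [← geom_sum_mul_neg, mul_assoc, hinv', mul_one]
  obtain ⟨s, hs1, hs2⟩ := exists_between ht
  have hs0 : 0 < s := hlam0.trans hs1
  have hSn : Tendsto (fun n : ℕ => ‖S ^ n‖) atTop (𝓝 0) := by
    refine squeeze_zero' (g := fun n : ℕ => (s / t) ^ n)
      (Eventually.of_forall fun n => norm_nonneg _) ?_
      (tendsto_pow_atTop_nhds_zero_of_lt_one (by positivity) ((div_lt_one ht0).2 hs2))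
    filter_upwards [(tendsto_norm_transfer_pow hG).eventually_lt_const hs1,
      eventually_ge_atTop 1] with n hn hn1
    have h1 : ‖T ^ n‖ ≤ s ^ n := by
      calc ‖T ^ n‖ = (‖T ^ n‖ ^ (1 / n : ℝ)) ^ n := by
            rw [one_div, Real.rpow_inv_natCast_pow (norm_nonneg _) (by omega)]
        _ ≤ s ^ n := pow_le_pow_left₀ (by positivity) hn.le n
    rw [hS, smul_pow, norm_smul, norm_pow, norm_inv, Real.norm_of_nonneg ht0.le, div_pow,
      div_eq_inv_mul, inv_pow]
    gcongr
  let x : Seq r := Classical.arbitrary _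
  -- Combines `λ^k ≤ ‖T^k‖` with bounded distortion.
  have hterm : ∀ k : ℕ, Real.exp (-(K / 2)) * (lam / t) ^ k ≤ (S ^ k) 1 x := fun k => by
    have h1 := (spectralRadius_transfer_pow_le hG k).trans
      (norm_transfer_pow_le_transfer_pow_one hK hG hGK k x)
    rw [← hlam, ← hT] at h1
    rw [hS, smul_pow, smul_apply, ContinuousMap.smul_apply, smul_eq_mul,
      div_pow, Real.exp_neg]
    rw [inv_mul_le_iff₀ (Real.exp_pos _), inv_pow, div_eq_inv_mul, mul_left_comm]
    exact mul_le_mul_of_nonneg_left h1 (by positivity)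
  have hn : ∀ n : ℕ, Real.exp (-(K / 2)) * (1 - (lam / t) ^ n) ≤
      (t - lam) * ((1 + ‖S ^ n‖) * ‖R‖) := fun n => by
    have h1 : Real.exp (-(K / 2)) * ∑ k ∈ Finset.range n, (lam / t) ^ k ≤
        (1 + ‖S ^ n‖) * (t * ‖R‖) := by
      calc _ ≤ ∑ k ∈ Finset.range n, (S ^ k) 1 x := by
            rw [Finset.mul_sum]
            exact Finset.sum_le_sum fun k _ => hterm k
        _ = (∑ k ∈ Finset.range n, S ^ k) 1 x := by simp
        _ ≤ ‖(∑ k ∈ Finset.range n, S ^ k) 1‖ :=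
          ContinuousMap.apply_le_norm _ x
        _ ≤ ‖∑ k ∈ Finset.range n, S ^ k‖ := by
          simpa using (∑ k ∈ Finset.range n, S ^ k).le_opNorm 1
        _ ≤ _ := by
          rw [hsum]
          refine (norm_mul_le _ _).trans ?_
          rw [norm_smul, Real.norm_of_nonneg ht0.le]
          gcongr
          exact (norm_sub_le _ _).trans_eq (by rw [norm_one])
    have h2 : (1 - (lam / t) ^ n) = (t - lam) / t * ∑ k ∈ Finset.range n, (lam / t) ^ k := by
      rw [← geom_sum_mul_neg, mul_comm, sub_div, div_self ht0.ne']
    have h3 := mul_le_mul_of_nonneg_left h1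
      (show 0 ≤ (t - lam) / t from div_nonneg (by linarith) ht0.le)
    calc _ = (t - lam) / t * (Real.exp (-(K / 2)) * ∑ k ∈ Finset.range n, (lam / t) ^ k) := by
          rw [h2]; ring
      _ ≤ _ := h3
      _ = _ := by field_simp
  have hl : Tendsto (fun n : ℕ => Real.exp (-(K / 2)) * (1 - (lam / t) ^ n)) atTop
      (𝓝 (Real.exp (-(K / 2)) * (1 - 0))) :=
    (tendsto_const_nhds.sub (tendsto_pow_atTop_nhds_zero_of_lt_one (by positivity)
      ((div_lt_one ht0).2 ht))).const_mul _
  have hr : Tendsto (fun n : ℕ => (t - lam) * ((1 + ‖S ^ n‖) * ‖R‖)) atTop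
      (𝓝 ((t - lam) * ((1 + 0) * ‖R‖))) :=
    ((hSn.const_add 1).mul_const _).const_mul _
  simpa using le_of_tendsto_of_tendsto' hl hr hn

theorem spectralRadius_mem_spectrum_real {K : ℝ} (hK : 0 ≤ K) (hG : ∀ x, 0 < G x)
    (hGK : LogLipschitz K G) :
    (spectralRadius ℂ (transfer ℂ G)).toReal ∈ spectrum ℝ (transfer ℝ G) :=
  mem_spectrum_of_le_mul_norm_resolvent _ (Real.exp_pos _) fun _ ht =>
    exp_neg_le_mul_norm_resolvent hK hG hGK ht

/-- The bound `≤` needs only equality of norms; `≥` holds because the complex radius is itself a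
real spectral value. -/
theorem spectralRadius_real_transfer_eq {K : ℝ} (hK : 0 ≤ K) (hG : ∀ x, 0 < G x)
    (hGK : LogLipschitz K G) :
    spectralRadius ℝ (transfer ℝ G) = spectralRadius ℂ (transfer ℂ G) := by
  refine (spectralRadius_real_transfer_le hG).antisymm ?_
  refine le_trans ?_ (le_iSup₂ (α := ENNReal) _ (spectralRadius_mem_spectrum_real hK hG hGK))
  rw [← enorm_eq_nnnorm, Real.enorm_eq_ofReal ENNReal.toReal_nonneg,
    ENNReal.ofReal_toReal spectralRadius_transfer_ne_top]

theorem tendstoUniformly_log_transfer_pow_one {K : ℝ} (hK : 0 ≤ K) (hG : ∀ x, 0 < G x)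
    (hGK : LogLipschitz K G) :
    TendstoUniformly (fun (n : ℕ) (x : Seq r) =>
        (1 / (n : ℝ)) * Real.log ((transfer ℝ G ^ n) 1 x))
      (fun _ => Real.log (spectralRadius ℂ (transfer ℂ G)).toReal) atTop := by
  set lam := (spectralRadius ℂ (transfer ℂ G)).toReal
  have hlog : Tendsto (fun n : ℕ => (1 / (n : ℝ)) * Real.log ‖transfer ℝ G ^ n‖) atTop
      (𝓝 (Real.log lam)) := by
    refine ((tendsto_norm_transfer_pow hG).log (spectralRadius_transfer_pos hG).ne').congr
      fun n => ?_
    refine Real.log_rpow ?_ _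
    rw [norm_transfer_pow ℝ hG]
    exact (transfer_pow_one_pos hG n (Classical.arbitrary _)).trans_le
      (ContinuousMap.apply_le_norm _ _)
  rw [Metric.tendstoUniformly_iff]
  intro ε hε
  -- Half of `ε` pays for Gelfand's limit, half for the distortion `K/(2n)`; `K + 1` avoids division
  -- by zero.
  filter_upwards [Metric.tendsto_nhds.1 hlog (ε / 2) (by positivity),
    (tendsto_one_div_atTop_nhds_zero_nat (𝕜 := ℝ)).eventually_lt_const
      (show 0 < ε / (K + 1) by positivity)] with n hn1 hn2 x
  have hpos := transfer_pow_one_pos hG n x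
  have hle : (transfer ℝ G ^ n) 1 x ≤ ‖transfer ℝ G ^ n‖ := by
    rw [norm_transfer_pow ℝ hG]
    exact ContinuousMap.apply_le_norm _ _
  have hlog1 := Real.log_le_log hpos hle
  have hlog2 := Real.log_le_log (hpos.trans_le hle)
    (norm_transfer_pow_le_transfer_pow_one hK hG hGK n x)
  rw [Real.log_mul (Real.exp_pos _).ne' hpos.ne', Real.log_exp] at hlog2
  have hn0 : 0 ≤ 1 / (n : ℝ) := by positivity
  have h1 := mul_le_mul_of_nonneg_left hlog1 hn0
  have h2 := mul_le_mul_of_nonneg_left hlog2 hn0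
  rw [lt_div_iff₀ (by positivity)] at hn2
  rw [Real.dist_eq, abs_lt] at hn1 ⊢
  constructor <;> nlinarith

end SpectralRadius

/-! ### Admissibility and the weight summed over `N`. -/

variable {A : ℕ → Seq r → ℝ} {β μ : ℝ}

theorem LowerSuperlinear.admissible (hβ : 0 < β) (h : LowerSuperlinear A μ) :
    Admissible A β μ := by
  intro x
  simp_rw [Finset.mul_sum]
  refine summable_sum fun a _ => ?_
  -- With `μ < K < liminf`, the terms are eventually below powers of `exp (-β(K - μ)) < 1`.
  obtain ⟨K, hμK, hK⟩ := EReal.lt_iff_exists_real_btwn.1 (h (prepend a x))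
  rw [EReal.coe_lt_coe_iff] at hμK
  refine summable_of_isBigO_nat (g := fun N : ℕ => Real.exp (-(β * (K - μ))) ^ N)
    (summable_geometric_of_lt_one (Real.exp_pos _).le
      (Real.exp_lt_one_iff.2 (neg_neg_of_pos (mul_pos hβ (sub_pos.2 hμK))))) ?_
  refine Asymptotics.IsBigO.of_bound 1 ?_
  filter_upwards [eventually_lt_of_lt_liminf hK, eventually_gt_atTop 0] with N hN hN0
  rw [EReal.coe_lt_coe_iff, lt_div_iff₀ (by exact_mod_cast hN0)] at hN
  rw [← Real.exp_add, ← Real.exp_nat_mul, one_mul, Real.norm_of_nonneg (Real.exp_pos _).le,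
    Real.norm_of_nonneg (Real.exp_pos _).le, Real.exp_le_exp]
  nlinarith

theorem Admissible.summable_exp (h : Admissible A β μ) (y : Seq r) :
    Summable fun N : ℕ => Real.exp (β * μ * N - β * A N y) := by
  refine Summable.of_nonneg_of_le (fun N => (Real.exp_pos _).le) (fun N => ?_)
    (h fun n => y (n + 1))
  rw [sub_eq_add_neg, Real.exp_add]
  refine mul_le_mul_of_nonneg_left ?_ (Real.exp_pos _).le
  have := Finset.single_le_sum
    (f := fun a : Fin r => Real.exp (-β * A N (prepend a fun n => y (n + 1))))
    (fun a _ => (Real.exp_pos _).le) (Finset.mem_univ (y 0))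
  rwa [prepend_tail, neg_mul] at this

theorem exp_le_exp_symDist_mul {M : ℝ} (hβ : 0 < β)
    (hA : ∀ N x y, |A N x - A N y| ≤ M * symDist x y) (N : ℕ) :
    LogLipschitz (β * M) fun x => Real.exp (β * μ * N - β * A N x) := by
  intro x y
  rw [← Real.exp_add, Real.exp_le_exp]
  nlinarith [mul_le_mul_of_nonneg_left (neg_le_of_abs_le (hA N x y)) hβ.le]

theorem exists_weight (hβ : 0 < β) {M : ℝ} (hM : 0 < M)
    (hA : ∀ N x y, |A N x - A N y| ≤ M * symDist x y) (h : Admissible A β μ) :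
    ∃ G : C(Seq r, ℝ), (∀ x, HasSum (fun N : ℕ => Real.exp (β * μ * N - β * A N x)) (G x)) ∧
      (∀ x, 0 < G x) ∧ LogLipschitz (β * M) G := by
  have hcont : Continuous fun x => ∑' N : ℕ, Real.exp (β * μ * N - β * A N x) := by
    rcases isEmpty_or_nonempty (Seq r) with he | ⟨⟨y⟩⟩
    · exact continuous_of_const fun x => he.elim x
    -- Weierstrass test: bounded distortion makes summability at the single point `y` a uniform
    -- majorant.
    refine continuous_tsum (fun N => ?_) ((h.summable_exp y).mul_left (Real.exp (β * M / 2)))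
      fun N x => ?_
    · have := continuous_of_symDist_bound hM.le (hA N)
      fun_prop
    · rw [Real.norm_of_nonneg (Real.exp_pos _).le]
      exact (exp_le_exp_symDist_mul hβ hA N).le_exp_half (by positivity)
        (fun z => (Real.exp_pos _).le) x y
  refine ⟨⟨_, hcont⟩, fun x => (h.summable_exp x).hasSum, fun x => ?_, fun x y => ?_⟩
  · exact (h.summable_exp x).tsum_pos (fun N => (Real.exp_pos _).le) 0 (Real.exp_pos _)
  · change ∑' N : ℕ, _ ≤ _ * ∑' N : ℕ, _
    rw [← tsum_mul_left]
    exact (h.summable_exp x).tsum_le_tsum (fun N => exp_le_exp_symDist_mul hβ hA N x y)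
      ((h.summable_exp y).mul_left _)

theorem isRuelleOperator_transfer (𝕜 : Type) [RCLike 𝕜] {G : C(Seq r, ℝ)}
    (hG : ∀ x, HasSum (fun N : ℕ => Real.exp (β * μ * N - β * A N x)) (G x)) :
    IsRuelleOperator 𝕜 A β μ (transfer 𝕜 G) := by
  intro f x
  rw [transfer_apply]
  simp_rw [Finset.mul_sum]
  refine hasSum_sum fun a _ => ?_
  refine (((RCLike.hasSum_ofReal 𝕜).2 (hG (prepend a x))).mul_right (f (prepend a x))).congr_fun
    fun N => ?_
  rw [← mul_assoc, ← RCLike.ofReal_mul, ← Real.exp_add, sub_eq_add_neg, neg_mul]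

end GrandCanonical

theorem mainTheorem4 (r : ℕ) (hr : 1 ≤ r) (A : ℕ → GrandCanonical.Seq r → ℝ) (β μ : ℝ)
    (hβ : 0 < β) (hμ : μ < 0)
    (hLip : GrandCanonical.UniformlyLipschitz A)
    (hSup : GrandCanonical.Superlinear A μ) :
    (GrandCanonical.LowerSuperlinear A μ → GrandCanonical.Admissible A β μ) ∧
    (GrandCanonical.Admissible A β μ →
      ∃ (L : C(GrandCanonical.Seq r, ℝ) →L[ℝ] C(GrandCanonical.Seq r, ℝ))
        (Lc : C(GrandCanonical.Seq r, ℂ) →L[ℂ] C(GrandCanonical.Seq r, ℂ)) (lam : ℝ),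
        GrandCanonical.IsRuelleOperator ℝ A β μ L ∧
        GrandCanonical.IsRuelleOperator ℂ A β μ Lc ∧
        0 < lam ∧
        spectralRadius ℝ L = ENNReal.ofReal lam ∧
        spectralRadius ℂ Lc = ENNReal.ofReal lam ∧
        (∀ (n : ℕ) (x : GrandCanonical.Seq r), 0 < (L ^ n) 1 x) ∧
        TendstoUniformly (fun (n : ℕ) (x : GrandCanonical.Seq r) =>
          (1 / (n : ℝ)) * Real.log ((L ^ n) 1 x)) (fun _ => Real.log lam) atTop) := by
  refine ⟨fun h => h.admissible hβ, fun h => ?_⟩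
  obtain ⟨M, hM, hA⟩ := hLip
  have : Nonempty (Fin r) := ⟨⟨0, hr⟩⟩
  obtain ⟨G, hsum, hG, hGK⟩ := GrandCanonical.exists_weight hβ hM hA h
  have hK : 0 ≤ β * M := by positivity
  have hlam := ENNReal.ofReal_toReal (GrandCanonical.spectralRadius_transfer_ne_top (G := G))
  exact ⟨GrandCanonical.transfer ℝ G, GrandCanonical.transfer ℂ G,
    (spectralRadius ℂ (GrandCanonical.transfer ℂ G)).toReal,
    GrandCanonical.isRuelleOperator_transfer ℝ hsum,
    GrandCanonical.isRuelleOperator_transfer ℂ hsum,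
    GrandCanonical.spectralRadius_transfer_pos hG,
    (GrandCanonical.spectralRadius_real_transfer_eq hK hG hGK).trans hlam.symm,
    hlam.symm,
    GrandCanonical.transfer_pow_one_pos hG,
    GrandCanonical.tendstoUniformly_log_transfer_pow_one hK hG hGK⟩
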